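/- For rational numbers $s,t$ let $K_{s,t}\subset\mathbb{C}$ denote the splitting field over $\mathbb{Q}$ of $$f(s,t,X)=X^{4}-2s(t^{2}+1)X^{2}+s^{2}t^{2}(t^{2}+1).$$ Let $s$ and $t$ be integers such that $s$ is squarefree, $t$ is odd and $\gcd(s,t^{2}+1)=1$. Then the number fields $K_{s,t}$, $K_{2s,t}$, $K_{-s,t}$ and $K_{-2s,t}$ all have the same discriminant $D$. There are positive integers $x,n,m$ with $n$ and $m$ squarefree and $t^{2}+1=x^{4}n^{2}m$, and for any such $x,n,m$, $$D=\frac{2^{8}s^{2}n^{2}m^{3}}{\gcd(m,n)^{2}}.$$ Furthermore: (i) the exponent of $2$ in $D$ is $11$; (ii) for every odd prime $p$ with $p\mid s$, the exponent of $p$ in $D$ is $2$; (iii) for every odd prime $q$ with $q\nmid s$ and $q\nmid t^{2}+1$, the exponent of $q$ in $D$ is $0$. -/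

import Mathlib

open Polynomial

/-- The quartic polynomial `f(s, t, X) = X⁴ - 2s(t² + 1)X² + s²t²(t² + 1)` over `ℚ`. -/
noncomputable def quarticPoly (s t : ℚ) : ℚ[X] :=
  X ^ 4 - C (2 * s * (t ^ 2 + 1)) * X ^ 2 + C (s ^ 2 * t ^ 2 * (t ^ 2 + 1))

/-- The field `K_{s,t}`: the splitting field of `f(s, t, X)` over `ℚ` inside `ℂ`, that is,
the subfield of `ℂ` generated over `ℚ` by the complex roots of `f(s, t, X)`. -/
noncomputable def quarticField (s t : ℚ) : IntermediateField ℚ ℂ :=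
  IntermediateField.adjoin ℚ ((quarticPoly s t).rootSet ℂ)

instance quarticField_isSplittingField (s t : ℚ) :
    (quarticPoly s t).IsSplittingField ℚ (quarticField s t) :=
  IntermediateField.adjoin_rootSet_isSplittingField (IsAlgClosed.splits _)

instance quarticField_numberField (s t : ℚ) : NumberField (quarticField s t) where
  to_charZero := inferInstance
  to_finiteDimensional :=
    Polynomial.IsSplittingField.finiteDimensional (quarticField s t) (quarticPoly s t)

/-! Put d = t² + 1 and δ = √d. Completing the square, f = (X² − sd)² − s²d, so its roots are ±α, ±β
with α² = s(d + δ), β² = s(d − δ) and αβ = ±stδ. Hence K = ℚ(α). If d = e²m with e = x²n and θ = √m,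
then δ = eθ and α² = sδ(1 + δ), so γ = α/x satisfies γ² = Aθ(1 + eθ) with A = sn. For the twists by
c ∈ {±1, ±2} only A changes, to csn.

The discriminant is found one prime at a time. If four integers of K span a subgroup that is maximal
at p, their discriminant is k² · `discr K` with p ∤ k, so it has the right p-adic valuation. Three
cases cover all primes. • p ∣ m (this includes p = 2): p is totally ramified and 1, γ, θ, γθ have
valuations 0, 1, 2, 3 above p once p ∤ A. If p divides A, replacing γ by γθ/p removes it. The
valuation is that of 2⁸m³, whatever c is. • p ∣ d, p ∤ m: p is odd and prime to t, and trace forms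
show that 1, θ, γ, γθ is p-maximal. The valuation is that of A², hence of (n / gcd(m, n))². • p ∤ d:
p may divide t, which is a factor of the index of 1, θ, γ, γθ. The tower with e = 1, M = d, A = cs
is used, and γθ is replaced by a conjugate of γ. The valuation is that of s². Since c divides 2, it
affects no odd prime, so the four discriminants agree; positivity fixes the sign. -/

open NumberField

/-! ### Discriminants of p-maximal families. -/

/-- If the integral family `b` spans a `p`-maximal subgroup of `𝓞 K`, then the discriminant of
`b` differs from that of `K` by the square of an integer prime to `p`. -/
theorem exists_discr_eq_sq_mul_discr_of_forall_dvd {K : Type*} [Field K] [NumberField K]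
    {ι : Type*} [Fintype ι] [DecidableEq ι] (hι : Fintype.card ι = Module.finrank ℚ K)
    (b : ι → 𝓞 K) {p : ℕ} (hp : p.Prime)
    (h : ∀ v : ι → ℤ, (p : 𝓞 K) ∣ ∑ i, (v i : 𝓞 K) * b i → ∀ i, (p : ℤ) ∣ v i) :
    ∃ k : ℤ, ¬ (p : ℤ) ∣ k ∧ Algebra.discr ℤ b = k ^ 2 * discr K := by
  classical
  have : Fact p.Prime := ⟨hp⟩
  have hcard : Fintype.card (Module.Free.ChooseBasisIndex ℤ (𝓞 K)) = Fintype.card ι := by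
    rw [hι, ← RingOfIntegers.rank K, Module.finrank_eq_card_chooseBasisIndex]
  let w : Module.Basis ι ℤ (𝓞 K) :=
    (RingOfIntegers.basis K).reindex (Fintype.equivOfCardEq hcard)
  let P : Matrix ι ι ℤ := Matrix.of fun i j => w.repr (b i) j
  have hb : ∀ i, b i = ∑ j, (P i j : 𝓞 K) * w j := fun i => by
    conv_lhs => rw [← w.sum_repr (b i)]
    simp [P, zsmul_eq_mul]
  refine ⟨P.det, ?_, ?_⟩
  · intro hdvd
    have hdet : (P.map (Int.castRingHom (ZMod p))).det = 0 := by
      rw [← RingHom.mapMatrix_apply, ← RingHom.map_det]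
      simpa using (ZMod.intCast_zmod_eq_zero_iff_dvd P.det p).2 hdvd
    -- A kernel vector of the transition matrix mod p lifts to a combination of the `b i` divisible
    -- by p whose coefficients are not all divisible by p.
    obtain ⟨u, hu0, hu⟩ := Matrix.exists_vecMul_eq_zero_iff.2 hdet
    choose v hv using fun i => ZMod.intCast_surjective (u i)
    apply hu0
    funext i
    rw [← hv i]
    refine (ZMod.intCast_zmod_eq_zero_iff_dvd _ _).2 (h v ?_ i)
    have hcol : ∀ j, (p : ℤ) ∣ ∑ i, v i * P i j := fun j => by
      rw [← ZMod.intCast_zmod_eq_zero_iff_dvd]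
      have := congrFun hu j
      simpa [Matrix.vecMul, dotProduct, ← hv] using this
    have : ∑ i, (v i : 𝓞 K) * b i = ∑ j, ((∑ i, v i * P i j : ℤ) : 𝓞 K) * w j := by
      simp_rw [hb, Finset.mul_sum]
      rw [Finset.sum_comm]
      simp [Finset.sum_mul, mul_assoc]
    rw [this]
    refine Finset.dvd_sum fun j _ => Dvd.dvd.mul_right ?_ _
    simpa using map_dvd (Int.castRingHom (𝓞 K)) (hcol j)
  · have : b = (P.map (algebraMap ℤ (𝓞 K))).mulVec w := by
      funext i
      simp [hb, Matrix.mulVec, dotProduct]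
    rw [this, Algebra.discr_of_matrix_mulVec, discr_eq_discr]

/-! ### The quartic tower ℚ ⊂ ℚ(θ) ⊂ ℚ(θ, γ): independence, traces, discriminant. -/

theorem eq_zero_of_add_mul_sqrt {F : Type*} [Field F] [CharZero F] {M : ℤ}
    (hM : ¬ IsSquare M) {θ : F} (hθ : θ ^ 2 = M) {a b : ℚ} (hab : (a : F) + b * θ = 0) :
    a = 0 ∧ b = 0 := by
  have hb : b = 0 := by
    by_contra hb
    apply hM
    rw [← Rat.isSquare_intCast_iff]
    refine ⟨a / b, ?_⟩
    have hb' : (b : F) ≠ 0 := by exact_mod_cast hb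
    have h1 : θ = -(a / b : F) := by field_simp; linear_combination hab
    have h2 : ((M : ℚ) : F) = ((a / b * (a / b) : ℚ) : F) := by
      push_cast
      rw [← hθ, h1]
      ring
    exact_mod_cast h2
  subst hb
  simpa using hab

/-- If γ lay in ℚ(θ), the square of its norm would be the norm of Aθ(1 + eθ), namely A²M(e²M − 1) =
A²t²M, making M a rational square. -/
theorem linearIndependent_of_sq_eq {F : Type*} [Field F] [CharZero F] {M A e t : ℤ}
    (hM : ¬ IsSquare M) (hA0 : A ≠ 0) (ht0 : t ≠ 0) (hn : e ^ 2 * M = t ^ 2 + 1) {θ γ : F}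
    (hθ : θ ^ 2 = M) (hγ : γ ^ 2 = A * θ * (1 + e * θ)) :
    LinearIndependent ℚ ![1, θ, γ, γ * θ] := by
  have hnorm : (e : ℚ) ^ 2 * M = t ^ 2 + 1 := by exact_mod_cast hn
  have key := @eq_zero_of_add_mul_sqrt F _ _ M hM θ hθ
  rw [Fintype.linearIndependent_iff]
  intro g hg
  simp only [Fin.sum_univ_four, Matrix.cons_val, Algebra.smul_def, eq_ratCast] at hg
  have hcd : g 2 = 0 ∧ g 3 = 0 := by
    by_contra hne
    have hN : g 2 ^ 2 - M * g 3 ^ 2 ≠ 0 := by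
      intro h0
      have h1 : ((g 2 : F) + g 3 * θ) * (g 2 - g 3 * θ) = 0 := by
        have : ((g 2 ^ 2 - M * g 3 ^ 2 : ℚ) : F) = 0 := by rw [h0]; simp
        push_cast at this
        linear_combination this - (g 3 : F) ^ 2 * hθ
      rcases mul_eq_zero.1 h1 with h1 | h1
      · exact hne (key h1)
      · have := @key (g 2) (-g 3) (by push_cast; linear_combination h1)
        exact hne ⟨this.1, by simpa using this.2⟩
    set N := g 2 ^ 2 - M * g 3 ^ 2 with hNdef
    set u := -(g 0 * g 2 - g 1 * g 3 * M) with hu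
    set v := -(g 1 * g 2 - g 0 * g 3) with hv
    -- Multiplying the relation by the conjugate g₂ − g₃θ solves it for γ. Squaring and comparing
    -- coefficients of 1 and θ then gives `hcoef`.
    have hγN : (N : F) * γ = u + v * θ := by
      rw [hNdef, hu, hv]
      push_cast
      linear_combination (g 2 - g 3 * θ : F) * hg + ((g 3 : F) ^ 2 * γ + g 1 * g 3) * hθ
    have hcoef := @key (N ^ 2 * A * e * M - (u ^ 2 + M * v ^ 2)) (N ^ 2 * A - 2 * u * v) (by
      push_cast
      linear_combination ((N : F) * γ + u + v * θ) * hγN - (N : F) ^ 2 * hγ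
        + ((v : F) ^ 2 - N ^ 2 * A * e) * hθ)
    apply hM
    rw [← Rat.isSquare_intCast_iff]
    refine ⟨(u ^ 2 - M * v ^ 2) / (N ^ 2 * A * t), ?_⟩
    have hA : (A : ℚ) ≠ 0 := by exact_mod_cast hA0
    have ht : (t : ℚ) ≠ 0 := by exact_mod_cast ht0
    have h1 := hcoef.1
    have h2 := hcoef.2
    field_simp
    linear_combination (N ^ 2 * A * e * M + (u ^ 2 + M * v ^ 2)) * h1
      - M * (N ^ 2 * A + 2 * u * v) * h2 - N ^ 4 * A ^ 2 * M * hnorm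
  have h01 := @key (g 0) (g 1) (by simpa [hcd.1, hcd.2] using hg)
  intro i
  fin_cases i
  exacts [h01.1, h01.2, hcd.1, hcd.2]

/-- A quartic field `K` with integral generators `θ`, `γ` such that `θ² = M` is a non-square,
`γ² = A θ (1 + e θ)` and `e² M = t² + 1`. -/
structure IsQuarticTower (K : Type*) [Field K] [NumberField K] (M A e t : ℤ) (θ γ : 𝓞 K) :
    Prop where
  finrank_eq : Module.finrank ℚ K = 4
  not_isSquare : ¬ IsSquare M
  ne_zero : A ≠ 0
  t_ne_zero : t ≠ 0
  sq_theta : θ ^ 2 = M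
  sq_gamma : γ ^ 2 = A * θ * (1 + e * θ)
  norm_eq : e ^ 2 * M = t ^ 2 + 1

namespace IsQuarticTower

variable {K : Type*} [Field K] [NumberField K] {M A e t : ℤ} {θ γ : 𝓞 K}

theorem trace_eq (h : IsQuarticTower K M A e t θ γ) {x : 𝓞 K} (a₀ a₁ a₂ a₃ : ℤ)
    (hx : x = a₀ + a₁ * θ + a₂ * γ + a₃ * (γ * θ)) : Algebra.trace ℤ (𝓞 K) x = 4 * a₀ := by
  subst hx
  have hθ : (θ : K) ^ 2 = M := by simpa using congrArg (algebraMap (𝓞 K) K) h.sq_theta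
  have hγ : (γ : K) ^ 2 = A * θ * (1 + e * θ) := by
    simpa using congrArg (algebraMap (𝓞 K) K) h.sq_gamma
  have hli : LinearIndependent ℚ ![(1 : K), θ, γ, γ * θ] :=
    linearIndependent_of_sq_eq h.not_isSquare h.ne_zero h.t_ne_zero h.norm_eq hθ hγ
  obtain ⟨b, hb⟩ : ∃ b : Module.Basis (Fin 4) ℚ K, ⇑b = ![(1 : K), θ, γ, γ * θ] :=
    ⟨basisOfLinearIndependentOfCardEqFinrank hli (by simpa using h.finrank_eq.symm),
      coe_basisOfLinearIndependentOfCardEqFinrank _ _⟩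
  have hrepr : ∀ (c : Fin 4 → ℚ) (x : K), x = c 0 + c 1 * θ + c 2 * γ + c 3 * (γ * θ) →
      ∀ i, b.repr x i = c i := fun c x hx i => by
    have : x = ∑ i, c i • b i := by
      rw [hx, Fin.sum_univ_four, hb]
      simp [Algebra.smul_def]
    rw [this, b.repr_sum_self]
  rw [← @Int.cast_inj ℚ, Algebra.coe_trace_int, Algebra.trace_eq_matrix_trace b, Matrix.trace,
    Fin.sum_univ_four]
  simp only [Matrix.diag, Algebra.leftMulMatrix_eq_repr_mul, hb, Matrix.cons_val]
  rw [hrepr ![a₀, a₁, a₂, a₃] _ (by simp), hrepr ![M * a₁, a₀, M * a₃, a₂] _ (by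
      simp; linear_combination ((a₁ : K) + a₃ * γ) * hθ),
    hrepr ![A * e * M * a₂ + A * M * a₃, A * a₂ + A * e * M * a₃, a₀, a₁] _ (by
      simp
      linear_combination ((a₂ : K) + a₃ * θ) * hγ
        + ((a₂ : K) * A * e + a₃ * A + a₃ * A * e * θ) * hθ),
    hrepr ![A * M * a₂ + A * e * M * M * a₃, A * e * M * a₂ + A * M * a₃, M * a₁, a₀] _ (by
      simp
      linear_combination ((a₂ : K) * θ + a₃ * θ ^ 2) * hγ
        + ((a₂ : K) * A + a₂ * A * e * θ + a₁ * γ + a₃ * A * θ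
          + a₃ * A * e * (θ ^ 2 + M)) * hθ)]
  simp
  ring

/-- The trace form is block diagonal, and the (γ, γθ) block contributes the factor e²M − 1 = t². -/
theorem discr_eq (h : IsQuarticTower K M A e t θ γ) :
    Algebra.discr ℤ ![1, θ, γ, γ * θ] = 2 ^ 8 * A ^ 2 * M ^ 3 * t ^ 2 := by
  have hθ := h.sq_theta
  have hγ := h.sq_gamma
  have e22 : γ * γ = A * e * M + A * θ := by linear_combination hγ + (A * e : 𝓞 K) * hθ
  have htr : Algebra.traceMatrix ℤ ![1, θ, γ, γ * θ] =
      !![4 * 1, 4 * 0, 4 * 0, 4 * 0; 4 * 0, 4 * M, 4 * 0, 4 * 0;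
        4 * 0, 4 * 0, 4 * (A * e * M), 4 * (A * M);
        4 * 0, 4 * 0, 4 * (A * M), 4 * (A * e * M ^ 2)] := by
    ext i j
    fin_cases i <;> fin_cases j
    · exact h.trace_eq 1 0 0 0 (by simp)
    · exact h.trace_eq 0 1 0 0 (by simp)
    · exact h.trace_eq 0 0 1 0 (by simp)
    · exact h.trace_eq 0 0 0 1 (by simp)
    · exact h.trace_eq 0 1 0 0 (by simp)
    · exact h.trace_eq M 0 0 0 (by simp; linear_combination hθ)
    · exact h.trace_eq 0 0 0 1 (by simp; ring)
    · exact h.trace_eq 0 0 M 0 (by simp; linear_combination γ * hθ)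
    · exact h.trace_eq 0 0 1 0 (by simp)
    · exact h.trace_eq 0 0 0 1 (by simp)
    · exact h.trace_eq (A * e * M) A 0 0 (by simp [e22])
    · exact h.trace_eq (A * M) (A * e * M) 0 0 (by
        simp; linear_combination θ * e22 + (A : 𝓞 K) * hθ)
    · exact h.trace_eq 0 0 0 1 (by simp)
    · exact h.trace_eq 0 0 M 0 (by simp; linear_combination γ * hθ)
    · exact h.trace_eq (A * M) (A * e * M) 0 0 (by
        simp; linear_combination θ * e22 + (A : 𝓞 K) * hθ)
    · exact h.trace_eq (A * e * M ^ 2) (A * M) 0 0 (by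
        simp; linear_combination θ ^ 2 * e22 + (A * e * M + A * θ : 𝓞 K) * hθ)
  rw [Algebra.discr_def, htr, Matrix.det_succ_row_zero]
  simp [Fin.sum_univ_four, Matrix.det_fin_three, Fin.succAbove]
  linear_combination (2 ^ 8 * A ^ 2 * M ^ 3 : ℤ) * h.norm_eq

end IsQuarticTower

/-! ### Divisibility by rational integers in the ring of integers. -/

section Divisibility

variable {K : Type*} [Field K] [NumberField K]

theorem intCast_dvd_intCast_ringOfIntegers {a b : ℤ} : (a : 𝓞 K) ∣ b ↔ a ∣ b := by
  refine ⟨fun ⟨y, hy⟩ => ?_, fun h => by simpa using map_dvd (Int.castRingHom (𝓞 K)) h⟩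
  rcases eq_or_ne a 0 with rfl | ha
  · simpa using hy
  have hy' : (b : K) = a * y := by simpa using congrArg (algebraMap (𝓞 K) K) hy
  have hyK : algebraMap ℚ K (b / a) = y := by
    have : (a : K) ≠ 0 := by exact_mod_cast ha
    simp [hy', this]
  have hint : IsIntegral ℤ ((b : ℚ) / a) := by
    rw [← isIntegral_algebraMap_iff (algebraMap ℚ K).injective, hyK]
    exact y.isIntegral_coe
  obtain ⟨c, hc⟩ := IsIntegrallyClosed.isIntegral_iff.1 hint
  refine ⟨c, ?_⟩
  have ha' : (a : ℚ) ≠ 0 := by exact_mod_cast ha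
  have : (b : ℚ) = a * c := by
    rw [show (c : ℚ) = b / a by simpa using hc]
    field_simp
  exact_mod_cast this

omit [NumberField K] in
theorem intCast_dvd_trace {a : ℤ} {x : 𝓞 K} (h : (a : 𝓞 K) ∣ x) :
    a ∣ Algebra.trace ℤ (𝓞 K) x := by
  obtain ⟨y, rfl⟩ := h
  rw [← zsmul_eq_mul, map_zsmul, smul_eq_mul]
  exact dvd_mul_right _ _

/-- An integral z whose fourth power divides an integer not divisible by p⁴ cannot absorb a full
factor p: if p ∤ c, taking fourth powers would give p⁴ ∣ k. -/
theorem dvd_of_dvd_intCast_mul {p : ℤ} (hp : Prime p) {c k : ℤ} {z w : 𝓞 K}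
    (hz : z ^ 4 * w = k) (hk : ¬ p ^ 4 ∣ k) (h : (p : 𝓞 K) ∣ c * z) : p ∣ c := by
  by_contra hc
  apply hk
  have h1 : p ^ 4 ∣ c ^ 4 * k := by
    rw [← intCast_dvd_intCast_ringOfIntegers (K := K)]
    push_cast
    rw [← hz, ← mul_assoc, ← mul_pow]
    exact (pow_dvd_pow_of_dvd h 4).mul_right w
  exact (((Prime.coprime_iff_not_dvd hp).2 hc).pow).dvd_of_dvd_mul_left h1

theorem Prime.dvd_of_sq_dvd_mul {p a b : ℤ} (hp : Prime p) (ha : ¬ p ^ 2 ∣ a)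
    (h : p ^ 2 ∣ a * b) : p ∣ b := by
  by_contra hb
  exact ha ((((Prime.coprime_iff_not_dvd hp).2 hb).pow_left).dvd_of_dvd_mul_right h)

theorem not_pow_four_dvd {p A M t : ℤ} (hp : Prime p) (hpM : p ∣ M)
    (hpM2 : ¬ p ^ 2 ∣ M) (hA : ¬ p ∣ A) (ht : ¬ p ∣ t) (i j : ℕ) :
    ¬ p ^ 4 ∣ A ^ i * M ^ 3 * t ^ j := by
  obtain ⟨N, rfl⟩ := hpM
  intro h
  have hN : ¬ p ∣ N := fun h => hpM2 (by rw [pow_two]; exact mul_dvd_mul_left p h)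
  rw [show A ^ i * (p * N) ^ 3 * t ^ j = p ^ 3 * (A ^ i * N ^ 3 * t ^ j) by ring, pow_succ,
    mul_dvd_mul_iff_left (pow_ne_zero _ hp.ne_zero)] at h
  rcases hp.dvd_or_dvd h with h | h
  · rcases hp.dvd_or_dvd h with h | h
    · exact hA (hp.dvd_of_dvd_pow h)
    · exact hN (hp.dvd_of_dvd_pow h)
  · exact ht (hp.dvd_of_dvd_pow h)

end Divisibility

/-! ### Maximality at p of explicit families. -/

namespace IsQuarticTower

variable {K : Type*} [Field K] [NumberField K] {M A e t : ℤ} {θ γ : 𝓞 K}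

/-- Above p, γ behaves as a uniformizer with γ⁴ equal to M times a unit, and θ is γ² times a unit.
The four terms have distinct valuations modulo that of p. Multiplying by γ³, θ, γ and 1 in turn
isolates v₀, v₂, v₁, v₃, everything else being divisible by p. -/
theorem dvd_of_dvd_sum_of_ramified (h : IsQuarticTower K M A e t θ γ) {p : ℤ} (hp : Prime p)
    (hpM : p ∣ M) (hpM2 : ¬ p ^ 2 ∣ M) (hA : ¬ p ∣ A) {v₀ v₁ v₂ v₃ : ℤ}
    (hv : (p : 𝓞 K) ∣ v₀ + v₁ * θ + v₂ * γ + v₃ * (γ * θ)) :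
    p ∣ v₀ ∧ p ∣ v₁ ∧ p ∣ v₂ ∧ p ∣ v₃ := by
  have hθ := h.sq_theta
  have hγ := h.sq_gamma
  have ht : ¬ p ∣ t := fun hd => hp.not_dvd_one <| by
    have := dvd_sub (hpM.mul_left (e ^ 2)) (hd.mul_left t)
    rwa [h.norm_eq, show t ^ 2 + 1 - t * t = 1 by ring] at this
  have hn : (e : 𝓞 K) ^ 2 * M = t ^ 2 + 1 := by exact_mod_cast h.norm_eq
  have hpθ : (p : 𝓞 K) ∣ θ ^ 2 := by rw [hθ]; exact intCast_dvd_intCast_ringOfIntegers.2 hpM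
  -- As p ∤ t, this makes 1 ± eθ units at p.
  have hN : (1 + e * θ) * (1 - e * θ) = - (t : 𝓞 K) ^ 2 := by
    linear_combination - hn - (e : 𝓞 K) ^ 2 * hθ
  have hγ4 : γ ^ 4 = θ ^ 2 * (A ^ 2 * (1 + e * θ) ^ 2) := by
    linear_combination (γ ^ 2 + A * θ * (1 + e * θ)) * hγ
  have hz : (γ * θ) ^ 4 * (1 - e * θ) ^ 2 = (A ^ 2 * M ^ 3 * t ^ 4 : ℤ) := by
    calc _ = θ ^ 4 * (θ ^ 2 * A ^ 2) * ((1 + e * θ) * (1 - e * θ)) ^ 2 := by rw [mul_pow, hγ4]; ring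
      _ = (θ ^ 2) ^ 3 * A ^ 2 * ((1 + e * θ) * (1 - e * θ)) ^ 2 := by ring
      _ = _ := by rw [hN, hθ]; push_cast; ring
  have hk := not_pow_four_dvd hp hpM hpM2 hA ht 2 4
  have h0 : p ∣ v₀ := by
    refine dvd_of_dvd_intCast_mul (z := γ ^ 3) (w := (1 - (e : 𝓞 K) * θ) ^ 6) hp ?_
      (not_pow_four_dvd hp hpM hpM2 hA ht 6 12) ?_
    · calc _ = (γ ^ 4) ^ 3 * (1 - e * θ) ^ 6 := by ring
        _ = (θ ^ 2) ^ 3 * A ^ 6 * ((1 + e * θ) * (1 - e * θ)) ^ 6 := by rw [hγ4]; ring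
        _ = _ := by rw [hN, hθ]; push_cast; ring
    · have h1 := dvd_sub (hv.mul_left (γ ^ 3)) (hpθ.mul_right
        (v₁ * γ * A * (1 + e * θ) + (v₂ + v₃ * θ) * (A ^ 2 * (1 + e * θ) ^ 2)))
      convert h1 using 1
      linear_combination - (v₁ * θ * γ) * hγ - (v₂ + v₃ * θ) * hγ4
  have hv0 := (intCast_dvd_intCast_ringOfIntegers (K := K)).2 h0
  have h2 : p ∣ v₂ := by
    refine dvd_of_dvd_intCast_mul hp hz hk ?_
    convert dvd_sub (dvd_sub (hv.mul_left θ) (hv0.mul_right θ))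
      (hpθ.mul_right (v₁ + v₃ * γ)) using 1
    ring
  have hv2 := (intCast_dvd_intCast_ringOfIntegers (K := K)).2 h2
  have h1 : p ∣ v₁ := by
    refine dvd_of_dvd_intCast_mul hp hz hk ?_
    convert dvd_sub (dvd_sub (dvd_sub (hv.mul_left γ) (hv0.mul_right γ)) (hv2.mul_right (γ * γ)))
      (hpθ.mul_right (v₃ * A * (1 + e * θ))) using 1
    linear_combination - (v₃ * θ) * hγ
  have hv1 := (intCast_dvd_intCast_ringOfIntegers (K := K)).2 h1
  refine ⟨h0, h1, h2, dvd_of_dvd_intCast_mul hp hz hk ?_⟩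
  convert dvd_sub (dvd_sub (dvd_sub hv hv0) (hv1.mul_right θ)) (hv2.mul_right γ) using 1
  ring

/-- Traces against 1 and θ give v₀ and v₁. The remaining part γ(v₂ + v₃θ) is divisible by p, so its
square is divisible by p². Multiplying by θ(1 − eθ) turns γ² into −AMt², and traces give two
conditions mod p, because p² ∤ A. -/
theorem dvd_of_dvd_sum_of_unramified (h : IsQuarticTower K M A e t θ γ) {p : ℤ} (hp : Prime p)
    (hp2 : ¬ p ∣ 2) (hpM : ¬ p ∣ M) (hpt : ¬ p ∣ t) (hA : ¬ p ^ 2 ∣ A) {v₀ v₁ v₂ v₃ : ℤ}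
    (hv : (p : 𝓞 K) ∣ v₀ + v₁ * θ + v₂ * γ + v₃ * (γ * θ)) :
    p ∣ v₀ ∧ p ∣ v₁ ∧ p ∣ v₂ ∧ p ∣ v₃ := by
  have hθ := h.sq_theta
  have hγ := h.sq_gamma
  have hn : (e : 𝓞 K) ^ 2 * M = t ^ 2 + 1 := by exact_mod_cast h.norm_eq
  have hp4 : ¬ p ∣ 4 := fun hd => hp2 (hp.dvd_of_dvd_pow (show p ∣ 2 ^ 2 from hd))
  have h0 : p ∣ v₀ := by
    have := intCast_dvd_trace hv
    rw [h.trace_eq v₀ v₁ v₂ v₃ rfl] at this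
    exact (hp.dvd_or_dvd this).resolve_left hp4
  have h1 : p ∣ v₁ := by
    have := intCast_dvd_trace (hv.mul_left θ)
    rw [h.trace_eq (M * v₁) v₀ (M * v₃) v₂ (by
      push_cast; linear_combination (v₁ + v₃ * γ : 𝓞 K) * hθ)] at this
    exact ((hp.dvd_or_dvd ((hp.dvd_or_dvd this).resolve_left hp4))).resolve_left hpM
  have hv0 := (intCast_dvd_intCast_ringOfIntegers (K := K)).2 h0
  have hv1 := (intCast_dvd_intCast_ringOfIntegers (K := K)).2 h1
  have hx : (p : 𝓞 K) ∣ γ * (v₂ + v₃ * θ) := by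
    convert dvd_sub (dvd_sub hv hv0) (hv1.mul_right θ) using 1
    ring
  have hxx : ((p ^ 2 : ℤ) : 𝓞 K) ∣ (γ * (v₂ + v₃ * θ)) ^ 2 := by
    push_cast
    exact pow_dvd_pow_of_dvd hx 2
  have hsq : (γ * (v₂ + v₃ * θ)) ^ 2 * (θ * (1 - e * θ)) =
      - (A * M * t ^ 2) * (v₂ ^ 2 + M * v₃ ^ 2 + 2 * v₂ * v₃ * θ) := by
    calc _ = γ ^ 2 * (θ * (1 - e * θ)) * (v₂ + v₃ * θ) ^ 2 := by ring
      _ = A * θ ^ 2 * (1 - e ^ 2 * θ ^ 2) * (v₂ ^ 2 + 2 * v₂ * v₃ * θ + v₃ ^ 2 * θ ^ 2) := by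
        rw [hγ]; ring
      _ = A * M * (1 - e ^ 2 * M) * (v₂ ^ 2 + 2 * v₂ * v₃ * θ + v₃ ^ 2 * M) := by rw [hθ]
      _ = _ := by rw [hn]; ring
  have hd1 : p ∣ v₂ ^ 2 + M * v₃ ^ 2 := by
    have := intCast_dvd_trace (hxx.mul_right (θ * (1 - e * θ)))
    rw [hsq, h.trace_eq (-(A * M * t ^ 2) * (v₂ ^ 2 + M * v₃ ^ 2))
      (-(A * M * t ^ 2) * (2 * v₂ * v₃)) 0 0 (by push_cast; ring),
      show 4 * (-(A * M * t ^ 2) * (v₂ ^ 2 + M * v₃ ^ 2)) =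
        A * (-4 * M * t ^ 2 * (v₂ ^ 2 + M * v₃ ^ 2)) by ring] at this
    simpa [hp.dvd_mul, hp4, hpM, hp.dvd_pow_iff_dvd, hpt] using hp.dvd_of_sq_dvd_mul hA this
  have hd2 : p ∣ v₂ ∨ p ∣ v₃ := by
    have := intCast_dvd_trace (hxx.mul_right (θ * (1 - e * θ) * θ))
    rw [← mul_assoc, hsq, h.trace_eq (-(A * M * t ^ 2) * (2 * v₂ * v₃ * M))
      (-(A * M * t ^ 2) * (v₂ ^ 2 + M * v₃ ^ 2)) 0 0 (by
        push_cast; linear_combination - (A * M * t ^ 2 * (2 * v₂ * v₃) : 𝓞 K) * hθ),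
      show 4 * (-(A * M * t ^ 2) * (2 * v₂ * v₃ * M)) =
        A * (-4 * M * t ^ 2 * (2 * v₂ * v₃ * M)) by ring] at this
    simpa [hp.dvd_mul, hp4, hp2, hpM, hp.dvd_pow_iff_dvd, hpt]
      using hp.dvd_of_sq_dvd_mul hA this
  refine ⟨h0, h1, ?_⟩
  rcases hd2 with hd2 | hd2
  · refine ⟨hd2, ?_⟩
    have := (dvd_add_right (dvd_pow hd2 two_ne_zero)).1 hd1
    exact hp.dvd_of_dvd_pow ((hp.dvd_or_dvd this).resolve_left hpM)
  · exact ⟨hp.dvd_of_dvd_pow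
      ((dvd_add_left ((dvd_pow hd2 two_ne_zero).mul_left M)).1 hd1), hd2⟩

/-- Passing from γθ to β = (γθ − γ)/t divides the discriminant by t², so primes dividing t no longer
matter. -/
theorem discr_eq_orthogonal (h : IsQuarticTower K M A 1 t θ γ) {β : 𝓞 K}
    (hβ : t * β = γ * (θ - 1)) : Algebra.discr ℤ ![1, θ, γ, β] = 2 ^ 8 * A ^ 2 * M ^ 3 := by
  have hθ := h.sq_theta
  have hγ := h.sq_gamma
  have ht := h.t_ne_zero
  have htO : (t : 𝓞 K) ≠ 0 := by exact_mod_cast ht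
  have hM : (M : 𝓞 K) = t ^ 2 + 1 := by
    have := h.norm_eq
    rw [one_pow, one_mul] at this
    exact_mod_cast this
  have hdet : Algebra.discr ℤ ![1, θ, γ, t * β] = t ^ 2 * Algebra.discr ℤ ![1, θ, γ, β] := by
    rw [show (![1, θ, γ, t * β] : Fin 4 → 𝓞 K) =
      ((Matrix.diagonal ![(1 : ℤ), 1, 1, t]).map (algebraMap ℤ (𝓞 K))).mulVec ![1, θ, γ, β] by
        rw [Matrix.diagonal_map (by simp)]
        ext i
        fin_cases i <;> simp [Matrix.mulVec_diagonal]]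
    rw [Algebra.discr_of_matrix_mulVec]
    simp [Fin.prod_univ_four]
  have hdet' : Algebra.discr ℤ ![1, θ, γ, t * β] = Algebra.discr ℤ ![1, θ, γ, γ * θ] := by
    rw [show (![1, θ, γ, t * β] : Fin 4 → 𝓞 K) =
      ((!![1, 0, 0, 0; 0, 1, 0, 0; 0, 0, 1, 0; 0, 0, -1, 1] : Matrix (Fin 4) (Fin 4) ℤ).map
        (algebraMap ℤ (𝓞 K))).mulVec ![1, θ, γ, γ * θ] by
        ext i
        fin_cases i <;> simp [Matrix.mulVec, dotProduct, Fin.sum_univ_four, hβ]; ring]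
    rw [Algebra.discr_of_matrix_mulVec]
    have : (!![1, 0, 0, 0; 0, 1, 0, 0; 0, 0, 1, 0; 0, 0, -1, 1] : Matrix (Fin 4) (Fin 4) ℤ).det
      = 1 := by decide
    rw [this, one_pow, one_mul]
  rw [hdet', h.discr_eq] at hdet
  exact mul_left_cancel₀ (pow_ne_zero 2 ht) (by linear_combination - hdet)

theorem dvd_of_dvd_sum_orthogonal (h : IsQuarticTower K M A 1 t θ γ) {β : 𝓞 K}
    (hβ : t * β = γ * (θ - 1)) {p : ℤ} (hp : Prime p)
    (hp2 : ¬ p ∣ 2) (hpM : ¬ p ∣ M) (hA : ¬ p ^ 2 ∣ A) {v₀ v₁ v₂ v₃ : ℤ}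
    (hv : (p : 𝓞 K) ∣ v₀ + v₁ * θ + v₂ * γ + v₃ * β) :
    p ∣ v₀ ∧ p ∣ v₁ ∧ p ∣ v₂ ∧ p ∣ v₃ := by
  have hθ := h.sq_theta
  have hγ := h.sq_gamma
  have htO : (t : 𝓞 K) ≠ 0 := by exact_mod_cast h.t_ne_zero
  have hM : M = t ^ 2 + 1 := by
    have := h.norm_eq
    rwa [one_pow, one_mul] at this
  have hMO : (M : 𝓞 K) = t ^ 2 + 1 := by exact_mod_cast hM
  have hp4 : ¬ p ∣ 4 := fun hd => hp2 (hp.dvd_of_dvd_pow (show p ∣ 2 ^ 2 from hd))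
  have htr : ∀ {x : 𝓞 K} (a₀ a₁ a₂ a₃ : ℤ), x = a₀ + a₁ * θ + a₂ * γ + a₃ * β →
      Algebra.trace ℤ (𝓞 K) x = 4 * a₀ := fun {x} a₀ a₁ a₂ a₃ hx => by
    have h1 := h.trace_eq (x := t * x) (t * a₀) (t * a₁) (t * a₂ - a₃) a₃ (by
      rw [hx]; push_cast; linear_combination (a₃ : 𝓞 K) * hβ)
    rw [← zsmul_eq_mul, map_zsmul, smul_eq_mul] at h1
    exact mul_left_cancel₀ h.t_ne_zero (by linear_combination h1)
  -- The multiplication table of β is checked after multiplying by t or t². The traces of γ² and β²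
  -- agree and that of γβ vanishes.
  have hγβ : γ * β = A * t * θ := mul_left_cancel₀ htO (by
    linear_combination γ * hβ + (θ - 1) * hγ + (A : 𝓞 K) * θ * hθ + A * θ * hMO)
  have hββ : β * β = A * (M - θ) := mul_left_cancel₀ (pow_ne_zero 2 htO) (by
    linear_combination (t * β + γ * (θ - 1)) * hβ + (θ - 1) ^ 2 * hγ
      + (A : 𝓞 K) * (θ ^ 2 - θ - 1 + M) * hθ + (A : 𝓞 K) * (M - θ) * hMO)
  have hθβ : θ * β = t * γ - β := mul_left_cancel₀ htO (by
    linear_combination (θ + 1) * hβ + γ * hθ + γ * hMO)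
  have h0 : p ∣ v₀ := by
    have := intCast_dvd_trace hv
    rw [htr v₀ v₁ v₂ v₃ rfl] at this
    exact (hp.dvd_or_dvd this).resolve_left hp4
  have hv0 := (intCast_dvd_intCast_ringOfIntegers (K := K)).2 h0
  have h1 : p ∣ v₁ := by
    have := intCast_dvd_trace (hv.mul_left θ)
    rw [htr (M * v₁) v₀ (v₂ + t * v₃) (t * v₂ - v₃) (by
      push_cast; linear_combination (v₁ : 𝓞 K) * hθ + (v₃ : 𝓞 K) * hθβ
        - (v₂ : 𝓞 K) * hβ)] at this
    exact ((hp.dvd_or_dvd ((hp.dvd_or_dvd this).resolve_left hp4))).resolve_left hpM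
  have hv1 := (intCast_dvd_intCast_ringOfIntegers (K := K)).2 h1
  have hx : (p : 𝓞 K) ∣ v₂ * γ + v₃ * β := by
    convert dvd_sub (dvd_sub hv hv0) (hv1.mul_right θ) using 1
    ring
  have hxx : ((p ^ 2 : ℤ) : 𝓞 K) ∣ (v₂ * γ + v₃ * β) ^ 2 := by
    push_cast
    exact pow_dvd_pow_of_dvd hx 2
  have hsq : (v₂ * γ + v₃ * β) ^ 2 =
      A * (M * (v₂ ^ 2 + v₃ ^ 2) + (v₂ ^ 2 - v₃ ^ 2 + 2 * v₂ * v₃ * t) * θ) := by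
    linear_combination (v₂ : 𝓞 K) ^ 2 * hγ + (v₂ : 𝓞 K) ^ 2 * A * hθ + (v₃ : 𝓞 K) ^ 2 * hββ
      + 2 * v₂ * v₃ * hγβ
  have hd1 : p ∣ v₂ ^ 2 + v₃ ^ 2 := by
    have := intCast_dvd_trace hxx
    rw [hsq, htr (A * (M * (v₂ ^ 2 + v₃ ^ 2))) (A * (v₂ ^ 2 - v₃ ^ 2 + 2 * v₂ * v₃ * t)) 0 0
      (by push_cast; ring), show 4 * (A * (M * (v₂ ^ 2 + v₃ ^ 2))) =
        A * (4 * M * (v₂ ^ 2 + v₃ ^ 2)) by ring] at this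
    simpa [hp.dvd_mul, hp4, hpM] using hp.dvd_of_sq_dvd_mul hA this
  have hd2 : p ∣ v₂ ^ 2 - v₃ ^ 2 + 2 * v₂ * v₃ * t := by
    have := intCast_dvd_trace (hxx.mul_right θ)
    rw [hsq, htr (A * (M * (v₂ ^ 2 - v₃ ^ 2 + 2 * v₂ * v₃ * t))) (A * M * (v₂ ^ 2 + v₃ ^ 2)) 0 0
      (by push_cast; linear_combination
            (A : 𝓞 K) * (v₂ ^ 2 - v₃ ^ 2 + 2 * v₂ * v₃ * t) * hθ),
      show 4 * (A * (M * (v₂ ^ 2 - v₃ ^ 2 + 2 * v₂ * v₃ * t))) =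
        A * (4 * M * (v₂ ^ 2 - v₃ ^ 2 + 2 * v₂ * v₃ * t)) by ring] at this
    simpa [hp.dvd_mul, hp4, hpM] using hp.dvd_of_sq_dvd_mul hA this
  have hd3 : p ∣ v₂ ∨ p ∣ v₃ := by
    -- Eliminating between the two quadratic conditions leaves (2v₂v₃)²(1 + t²), and 1 + t² = M is
    -- prime to p.
    have : p ∣ (2 * v₂ * v₃) ^ 2 * M := by
      have := dvd_sub (hd1.mul_left (v₂ ^ 2 + v₃ ^ 2))
        (hd2.mul_left (v₂ ^ 2 - v₃ ^ 2 - 2 * v₂ * v₃ * t))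
      rwa [show (v₂ ^ 2 + v₃ ^ 2) * (v₂ ^ 2 + v₃ ^ 2) - (v₂ ^ 2 - v₃ ^ 2 - 2 * v₂ * v₃ * t) *
        (v₂ ^ 2 - v₃ ^ 2 + 2 * v₂ * v₃ * t) = (2 * v₂ * v₃) ^ 2 * M by rw [hM]; ring] at this
    simpa [hp.dvd_mul, hp2, hpM, hp.dvd_pow_iff_dvd] using this
  refine ⟨h0, h1, ?_⟩
  rcases hd3 with hd3 | hd3
  · exact ⟨hd3, hp.dvd_of_dvd_pow ((dvd_add_right (dvd_pow hd3 two_ne_zero)).1 hd1)⟩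
  · exact ⟨hp.dvd_of_dvd_pow ((dvd_add_left (dvd_pow hd3 two_ne_zero)).1 hd1), hd3⟩

end IsQuarticTower

/-! ### Valuations of the discriminant of a tower. -/

theorem padicValInt_eq_of_sq_mul_eq {p : ℕ} (hp : p.Prime) {N k D : ℤ} (hk : ¬ (p : ℤ) ∣ k)
    (h : N = k ^ 2 * D) : padicValInt p D = padicValInt p N := by
  have : Fact p.Prime := ⟨hp⟩
  rcases eq_or_ne D 0 with rfl | hD
  · simp [h]
  have hk0 : k ≠ 0 := by rintro rfl; exact hk (dvd_zero _)
  rw [h, padicValInt.mul (pow_ne_zero 2 hk0) hD, padicValInt.eq_zero_of_not_dvd (z := k ^ 2), zero_add]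
  exact fun h => hk ((Nat.prime_iff_prime_int.1 hp).dvd_of_dvd_pow h)

theorem Nat.Prime.not_dvd_two_int {p : ℕ} (hp : p.Prime) (hp2 : p ≠ 2) : ¬ (p : ℤ) ∣ 2 := by
  exact_mod_cast fun hd => hp2 ((Nat.prime_dvd_prime_iff_eq hp Nat.prime_two).1 hd)

namespace IsQuarticTower

variable {K : Type*} [Field K] [NumberField K] {M A e t : ℤ} {θ γ : 𝓞 K}

theorem exists_discr_eq_of_dvd (h : IsQuarticTower K M A e t θ γ) (b : Fin 4 → 𝓞 K) {p : ℕ}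
    (hp : p.Prime) (hb : ∀ v₀ v₁ v₂ v₃ : ℤ,
      ((p : ℤ) : 𝓞 K) ∣ v₀ * b 0 + v₁ * b 1 + v₂ * b 2 + v₃ * b 3 →
        (p : ℤ) ∣ v₀ ∧ (p : ℤ) ∣ v₁ ∧ (p : ℤ) ∣ v₂ ∧ (p : ℤ) ∣ v₃) :
    ∃ k : ℤ, ¬ (p : ℤ) ∣ k ∧ Algebra.discr ℤ b = k ^ 2 * discr K := by
  refine exists_discr_eq_sq_mul_discr_of_forall_dvd (by simp [h.finrank_eq]) b hp
    fun v hv => ?_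
  rw [Fin.sum_univ_four] at hv
  obtain ⟨h0, h1, h2, h3⟩ := hb _ _ _ _ (by simpa using hv)
  intro i
  fin_cases i
  exacts [h0, h1, h2, h3]

/-- Since γ² = A(M + θ), the element β = γ(θ − 1)/t has β² = A(M − θ): it is a square root of the
conjugate of γ², hence integral. -/
theorem exists_conjugate (h : IsQuarticTower K M A 1 t θ γ) :
    ∃ β : 𝓞 K, t * β = γ * (θ - 1) := by
  have hθ : (θ : K) ^ 2 = M := by simpa using congrArg (algebraMap (𝓞 K) K) h.sq_theta
  have hγ : (γ : K) ^ 2 = A * θ * (1 + θ) := by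
    simpa using congrArg (algebraMap (𝓞 K) K) h.sq_gamma
  have ht : (t : K) ≠ 0 := by exact_mod_cast h.t_ne_zero
  have hM : (M : K) = t ^ 2 + 1 := by
    have := h.norm_eq
    rw [one_pow, one_mul] at this
    exact_mod_cast this
  have hint : IsIntegral ℤ ((γ * (θ - 1) / t : K)) := by
    refine IsIntegral.of_pow two_pos ?_
    have : (γ * (θ - 1) / t : K) ^ 2 = ((A * (M - θ) : 𝓞 K) : K) := by
      push_cast
      field_simp
      simp only [map_intCast]
      linear_combination (θ - 1 : K) ^ 2 * hγ + (A : K) * (θ ^ 2 - θ - 1 + M) * hθ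
        + (A : K) * (M - θ) * hM
    rw [this]
    exact RingOfIntegers.isIntegral_coe _
  obtain ⟨β, hβ⟩ : ∃ β : 𝓞 K, (β : K) = γ * (θ - 1) / t := ⟨⟨_, hint⟩, rfl⟩
  refine ⟨β, RingOfIntegers.ext ?_⟩
  simp [hβ]
  field_simp

/-- The new generator is γθ/p, whose square is (AM/p²)θ(1 + eθ). When p² divides neither A nor M,
the new coefficient is prime to p. -/
theorem exists_twist (h : IsQuarticTower K M A e t θ γ) {p A' M' : ℤ} (hp : p ≠ 0)
    (hA : A = p * A') (hM : M = p * M') :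
    ∃ γ' : 𝓞 K, IsQuarticTower K M (A' * M') e t θ γ' := by
  have hθ : (θ : K) ^ 2 = M := by simpa using congrArg (algebraMap (𝓞 K) K) h.sq_theta
  have hγ : (γ : K) ^ 2 = A * θ * (1 + e * θ) := by
    simpa using congrArg (algebraMap (𝓞 K) K) h.sq_gamma
  have hp' : (p : K) ≠ 0 := by exact_mod_cast hp
  have hA' : A' ≠ 0 := by rintro rfl; exact h.ne_zero (by simpa using hA)
  have hM' : M' ≠ 0 := by rintro rfl; exact h.not_isSquare (by simp [hM])
  have hsq : (γ * θ / p : K) ^ 2 = ((A' * M' : ℤ) * θ * (1 + e * θ) : 𝓞 K) := by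
    simp only [map_mul, map_add, map_one, map_intCast, Int.cast_mul]
    rw [div_pow, mul_pow, hγ, hθ, hA, hM]
    push_cast
    field_simp
  have hint : IsIntegral ℤ (γ * θ / p : K) := by
    refine IsIntegral.of_pow two_pos ?_
    rw [hsq]
    exact RingOfIntegers.isIntegral_coe _
  obtain ⟨γ', hγ'⟩ : ∃ γ' : 𝓞 K, (γ' : K) = γ * θ / p := ⟨⟨_, hint⟩, rfl⟩
  rw [← hγ'] at hsq
  exact ⟨γ', h.finrank_eq, h.not_isSquare, mul_ne_zero hA' hM', h.t_ne_zero, h.sq_theta,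
    RingOfIntegers.ext hsq, h.norm_eq⟩

theorem M_pos (h : IsQuarticTower K M A e t θ γ) : 0 < M := by
  have := h.norm_eq
  by_contra hM
  nlinarith [sq_nonneg e, sq_nonneg t]

theorem padicValInt_discr_of_dvd_of_not_dvd (h : IsQuarticTower K M A e t θ γ) {p : ℕ}
    (hp : p.Prime) (hpM : (p : ℤ) ∣ M) (hpM2 : ¬ (p : ℤ) ^ 2 ∣ M) (hA : ¬ (p : ℤ) ∣ A) :
    0 < discr K ∧ padicValInt p (discr K) = padicValInt p (2 ^ 8 * M ^ 3) := by
  have hp' := Nat.prime_iff_prime_int.1 hp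
  obtain ⟨k, hk, hkD⟩ := h.exists_discr_eq_of_dvd ![1, θ, γ, γ * θ] hp fun v₀ v₁ v₂ v₃ hv =>
    h.dvd_of_dvd_sum_of_ramified hp' hpM hpM2 hA (by simpa using hv)
  rw [h.discr_eq] at hkD
  refine ⟨?_, ?_⟩
  · have h1 := h.ne_zero
    have h2 := h.t_ne_zero
    have h3 := h.M_pos
    have : 0 < k ^ 2 * discr K := by rw [← hkD]; positivity
    exact pos_of_mul_pos_right this (sq_nonneg k)
  · rw [padicValInt_eq_of_sq_mul_eq hp hk hkD]
    refine (padicValInt_eq_of_sq_mul_eq hp (k := A * t) ?_ (by ring)).symm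
    intro hd
    rcases hp'.dvd_or_dvd hd with hd | hd
    · exact hA hd
    · have := dvd_sub (hpM.mul_left (e ^ 2)) (hd.mul_left t)
      rw [h.norm_eq, show t ^ 2 + 1 - t * t = 1 by ring] at this
      exact hp'.not_dvd_one this

theorem padicValInt_discr_of_dvd (h : IsQuarticTower K M A e t θ γ) {p : ℕ}
    (hp : p.Prime) (hpM : (p : ℤ) ∣ M) (hpM2 : ¬ (p : ℤ) ^ 2 ∣ M) (hA : ¬ (p : ℤ) ^ 2 ∣ A) :
    0 < discr K ∧ padicValInt p (discr K) = padicValInt p (2 ^ 8 * M ^ 3) := by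
  by_cases hpA : (p : ℤ) ∣ A
  · have hp' := Nat.prime_iff_prime_int.1 hp
    obtain ⟨A', hA'⟩ := hpA
    obtain ⟨M', hM'⟩ := hpM
    obtain ⟨γ', h'⟩ := h.exists_twist hp'.ne_zero hA' hM'
    refine h'.padicValInt_discr_of_dvd_of_not_dvd hp ⟨M', hM'⟩ hpM2 fun hd => ?_
    rcases hp'.dvd_or_dvd hd with hd | hd
    · exact hA (by rw [hA', pow_two]; exact mul_dvd_mul_left _ hd)
    · exact hpM2 (by rw [hM', pow_two]; exact mul_dvd_mul_left _ hd)
  · exact h.padicValInt_discr_of_dvd_of_not_dvd hp hpM hpM2 hpA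

theorem padicValInt_discr_of_not_dvd (h : IsQuarticTower K M A e t θ γ) {p : ℕ}
    (hp : p.Prime) (hp2 : p ≠ 2) (hpM : ¬ (p : ℤ) ∣ M) (hpt : ¬ (p : ℤ) ∣ t)
    (hA : ¬ (p : ℤ) ^ 2 ∣ A) : padicValInt p (discr K) = padicValInt p (A ^ 2) := by
  have hp' := Nat.prime_iff_prime_int.1 hp
  have hp2' : ¬ (p : ℤ) ∣ 2 := hp.not_dvd_two_int hp2
  have hp256 : ¬ (p : ℤ) ∣ 256 := fun hd => hp2' (hp'.dvd_of_dvd_pow (show (p : ℤ) ∣ 2 ^ 8 from hd))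
  obtain ⟨k, hk, hkD⟩ := h.exists_discr_eq_of_dvd ![1, θ, γ, γ * θ] hp fun v₀ v₁ v₂ v₃ hv =>
    h.dvd_of_dvd_sum_of_unramified hp' hp2' hpM hpt hA (by simpa using hv)
  rw [h.discr_eq] at hkD
  have : Fact p.Prime := ⟨hp⟩
  rw [padicValInt_eq_of_sq_mul_eq hp hk hkD, show 2 ^ 8 * A ^ 2 * M ^ 3 * t ^ 2 =
    A ^ 2 * (2 ^ 8 * M ^ 3 * t ^ 2) by ring, padicValInt.mul (pow_ne_zero 2 h.ne_zero)
      (by have := h.M_pos; have := h.t_ne_zero; positivity),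
    padicValInt.eq_zero_of_not_dvd (z := 2 ^ 8 * M ^ 3 * t ^ 2), add_zero]
  simp [hp'.dvd_mul, hp'.dvd_pow_iff_dvd, hp256, hpM, hpt]

theorem padicValInt_discr_of_e_eq_one (h : IsQuarticTower K M A 1 t θ γ) {p : ℕ}
    (hp : p.Prime) (hp2 : p ≠ 2) (hpM : ¬ (p : ℤ) ∣ M)
    (hA : ¬ (p : ℤ) ^ 2 ∣ A) : padicValInt p (discr K) = padicValInt p (A ^ 2) := by
  have hp' := Nat.prime_iff_prime_int.1 hp
  have hp2' : ¬ (p : ℤ) ∣ 2 := hp.not_dvd_two_int hp2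
  have hp256 : ¬ (p : ℤ) ∣ 256 := fun hd => hp2' (hp'.dvd_of_dvd_pow (show (p : ℤ) ∣ 2 ^ 8 from hd))
  obtain ⟨β, hβ⟩ := h.exists_conjugate
  obtain ⟨k, hk, hkD⟩ := h.exists_discr_eq_of_dvd ![1, θ, γ, β] hp fun v₀ v₁ v₂ v₃ hv =>
    h.dvd_of_dvd_sum_orthogonal hβ hp' hp2' hpM hA (by simpa using hv)
  rw [h.discr_eq_orthogonal hβ] at hkD
  have : Fact p.Prime := ⟨hp⟩
  rw [padicValInt_eq_of_sq_mul_eq hp hk hkD, show 2 ^ 8 * A ^ 2 * M ^ 3 =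
    A ^ 2 * (2 ^ 8 * M ^ 3) by ring, padicValInt.mul (pow_ne_zero 2 h.ne_zero)
      (by have := h.M_pos; positivity),
    padicValInt.eq_zero_of_not_dvd (z := 2 ^ 8 * M ^ 3), add_zero]
  simp [hp'.dvd_mul, hp'.dvd_pow_iff_dvd, hp256, hpM]

end IsQuarticTower

/-! ### The splitting field as a quartic tower. -/

section QuarticField

theorem not_isSquare_of_sq_mul_eq {M e t : ℤ} (ht : t ≠ 0) (h : e ^ 2 * M = t ^ 2 + 1) :
    ¬ IsSquare M := by
  rintro ⟨k, rfl⟩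
  have hpos : 0 < |t| := abs_pos.2 ht
  have h1 : |t| ^ 2 + 1 = |e * k| ^ 2 := by rw [sq_abs, sq_abs]; linarith
  have h2 : |t| < |e * k| := lt_of_pow_lt_pow_left₀ 2 (abs_nonneg _) (by omega)
  nlinarith

theorem natDegree_quarticPoly (s t : ℚ) : (quarticPoly s t).natDegree = 4 := by
  rw [quarticPoly]
  compute_degree!

theorem quarticPoly_ne_zero (s t : ℚ) : quarticPoly s t ≠ 0 :=
  ne_zero_of_natDegree_gt (n := 0) (by rw [natDegree_quarticPoly]; norm_num)

theorem aeval_quarticPoly (s t : ℚ) (r : ℂ) :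
    aeval r (quarticPoly s t) = (r ^ 2 - s * (t ^ 2 + 1)) ^ 2 - s ^ 2 * (t ^ 2 + 1) := by
  simp only [quarticPoly, map_add, map_sub, map_mul, map_pow, aeval_X, aeval_C, eq_ratCast,
    map_ofNat, map_one]
  ring

/-- If `α² = s (d + δ)` with `δ² = d = t² + 1`, then `K_{s,t}` is generated by `α`. -/
theorem quarticField_eq_adjoin {s t : ℚ} (hs : s ≠ 0) (ht : t ≠ 0) {δ α : ℂ}
    (hδ : δ ^ 2 = (t : ℂ) ^ 2 + 1) (hα : α ^ 2 = s * (t ^ 2 + 1 + δ)) :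
    quarticField s t = IntermediateField.adjoin ℚ {α} := by
  have hsC : (s : ℂ) ≠ 0 := by exact_mod_cast hs
  have htC : (t : ℂ) ≠ 0 := by exact_mod_cast ht
  have hroot : ∀ r : ℂ, r ∈ (quarticPoly s t).rootSet ℂ ↔
      (r ^ 2 - s * (t ^ 2 + 1)) ^ 2 = (s * δ) ^ 2 := fun r => by
    rw [mem_rootSet_of_ne (quarticPoly_ne_zero s t), aeval_quarticPoly, mul_pow, hδ, sub_eq_zero]
  have hα0 : α ≠ 0 := by
    rintro rfl
    have h1 : (t : ℂ) ^ 2 + 1 + δ = 0 := by simpa [hsC] using hα.symm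
    have h2 : (t : ℂ) ^ 2 * (t ^ 2 + 1) = 0 := by
      linear_combination (t ^ 2 + 1 - δ : ℂ) * h1 + hδ
    have h3 : t ^ 2 * (t ^ 2 + 1) = 0 := by exact_mod_cast h2
    have : 0 < t ^ 2 * (t ^ 2 + 1) := by positivity
    exact this.ne' h3
  apply le_antisymm
  · refine IntermediateField.adjoin_le_iff.2 fun r hr => ?_
    have hαm : α ∈ IntermediateField.adjoin ℚ {α} := IntermediateField.mem_adjoin_simple_self ℚ α
    have hq : ∀ q : ℚ, (q : ℂ) ∈ IntermediateField.adjoin ℚ {α} := fun q => by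
      exact (IntermediateField.adjoin ℚ {α}).algebraMap_mem q
    have hδm : δ ∈ IntermediateField.adjoin ℚ {α} := by
      have : δ = α ^ 2 / s - (t ^ 2 + 1 : ℚ) := by
        rw [hα]; push_cast; field_simp; ring
      rw [this]
      exact sub_mem (div_mem (pow_mem hαm 2) (hq s)) (hq _)
    -- The other pair of roots is ±stδ/α, because the product of α² and its conjugate is s²t²d =
    -- (stδ)².
    have hβm : s * t * δ / α ∈ IntermediateField.adjoin ℚ {α} :=
      div_mem (mul_mem (mul_mem (hq s) (hq t)) hδm) hαm
    have hβ : (s * t * δ / α) ^ 2 = s * (t ^ 2 + 1 - δ) := by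
      rw [div_pow, div_eq_iff (pow_ne_zero 2 hα0), hα]
      linear_combination (s : ℂ) ^ 2 * (t ^ 2 + 1) * hδ
    rcases sq_eq_sq_iff_eq_or_eq_neg.1 ((hroot r).1 hr) with h | h
    · rcases sq_eq_sq_iff_eq_or_eq_neg.1 (show r ^ 2 = α ^ 2 by linear_combination h - hα)
        with rfl | rfl
      exacts [hαm, neg_mem hαm]
    · rcases sq_eq_sq_iff_eq_or_eq_neg.1
        (show r ^ 2 = (s * t * δ / α) ^ 2 by linear_combination h - hβ) with rfl | rfl
      exacts [hβm, neg_mem hβm]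
  · rw [IntermediateField.adjoin_simple_le_iff]
    exact IntermediateField.subset_adjoin ℚ _ ((hroot α).2 (by rw [hα]; ring))

/-- With δ = x²nθ, α² = sδ(1 + δ) equals x² · snθ(1 + x²nθ). Taking γ = α/x removes the square x²,
which accounts for A = sn. -/
theorem exists_isQuarticTower {s t x n M : ℤ} (hs : s ≠ 0) (ht : t ≠ 0)
    (h : (x ^ 2 * n) ^ 2 * M = t ^ 2 + 1) :
    ∃ θ γ : 𝓞 (quarticField s t),
      IsQuarticTower (quarticField s t) M (s * n) (x ^ 2 * n) t θ γ := by
  have hxn : x ^ 2 * n ≠ 0 := by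
    intro h0
    rw [h0] at h
    nlinarith [sq_nonneg t]
  have hn : n ≠ 0 := right_ne_zero_of_mul hxn
  have hx : x ≠ 0 := by rintro rfl; simp at hxn
  have hM := not_isSquare_of_sq_mul_eq ht h
  have hsC : (s : ℂ) ≠ 0 := by exact_mod_cast hs
  have hxC : (x : ℂ) ≠ 0 := by exact_mod_cast hx
  have hnC : (n : ℂ) ≠ 0 := by exact_mod_cast hn
  have hC : ((x : ℂ) ^ 2 * n) ^ 2 * M = t ^ 2 + 1 := by exact_mod_cast h
  obtain ⟨θ, hθ⟩ := IsAlgClosed.exists_pow_nat_eq (M : ℂ) two_pos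
  obtain ⟨γ, hγ⟩ := IsAlgClosed.exists_pow_nat_eq (s * n * θ * (1 + x ^ 2 * n * θ) : ℂ) two_pos
  have hK : quarticField s t = IntermediateField.adjoin ℚ {x * γ} :=
    quarticField_eq_adjoin (δ := x ^ 2 * n * θ) (by exact_mod_cast hs) (by exact_mod_cast ht)
      (by push_cast; rw [mul_pow, hθ, hC]) (by
        push_cast
        rw [mul_pow, hγ, ← hC, ← hθ]
        ring)
  have hαm : x * γ ∈ quarticField s t := by
    rw [hK]; exact IntermediateField.mem_adjoin_simple_self ℚ _
  have hz : ∀ q : ℤ, (q : ℂ) ∈ quarticField s t := fun q => intCast_mem _ q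
  have hγm : γ ∈ quarticField s t := by
    rw [show γ = x * γ / x by field_simp]
    exact div_mem hαm (hz x)
  have hθm : θ ∈ quarticField s t := by
    have : θ = (γ ^ 2 / (s * n) - (x ^ 2 * n) * M) := by
      rw [hγ, ← hθ]; field_simp; ring
    rw [this]
    exact sub_mem (div_mem (pow_mem hγm 2) (mul_mem (hz s) (hz n)))
      (mul_mem (mul_mem (pow_mem (hz x) 2) (hz n)) (hz M))
  have hθi : IsIntegral ℤ (⟨θ, hθm⟩ : quarticField s t) := by
    refine IsIntegral.of_pow two_pos ?_
    rw [show (⟨θ, hθm⟩ : quarticField s t) ^ 2 = (M : ℤ) from Subtype.ext (by simpa using hθ)]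
    exact isIntegral_algebraMap (R := ℤ) (x := M)
  obtain ⟨θ', hθ'⟩ : ∃ y : 𝓞 (quarticField s t), (y : quarticField s t) = ⟨θ, hθm⟩ :=
    ⟨⟨_, hθi⟩, rfl⟩
  have hγsq : (⟨γ, hγm⟩ : quarticField s t) ^ 2 =
      (((s * n : ℤ) * θ' * (1 + (x ^ 2 * n : ℤ) * θ') : 𝓞 (quarticField s t)) :
        quarticField s t) := by
    simp only [map_mul, map_add, map_one, map_intCast, hθ']
    exact Subtype.ext (by simpa using hγ)
  have hγi : IsIntegral ℤ (⟨γ, hγm⟩ : quarticField s t) := by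
    refine IsIntegral.of_pow two_pos ?_
    rw [hγsq]
    exact RingOfIntegers.isIntegral_coe _
  have hθsq : θ' ^ 2 = M := RingOfIntegers.ext <| by
    simp only [map_pow, map_intCast, hθ']
    exact Subtype.ext (by simpa using hθ)
  have hli := linearIndependent_of_sq_eq (F := quarticField s t) hM (mul_ne_zero hs hn) ht h
    (θ := ⟨θ, hθm⟩) (γ := ⟨γ, hγm⟩) (Subtype.ext (by simpa using hθ))
    (Subtype.ext (by simpa using hγ))
  have hfin : Module.finrank ℚ (quarticField s t) = 4 := by
    apply le_antisymm
    · have hroot : aeval (x * γ : ℂ) (quarticPoly s t) = 0 := by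
        rw [aeval_quarticPoly]
        push_cast
        rw [mul_pow, hγ, ← hC, ← hθ]
        ring
      rw [hK, IntermediateField.adjoin.finrank
        (isAlgebraic_iff_isIntegral.1 ⟨_, quarticPoly_ne_zero s t, hroot⟩),
        ← natDegree_quarticPoly s t]
      exact natDegree_le_of_dvd (minpoly.dvd ℚ _ hroot) (quarticPoly_ne_zero s t)
    · simpa using hli.fintype_card_le_finrank
  exact ⟨θ', ⟨_, hγi⟩, hfin, hM, mul_ne_zero hs hn, ht, hθsq, RingOfIntegers.ext hγsq, h⟩

end QuarticField

/-! ### Assembling the local computations. -/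

section Discriminant

theorem padicValInt_mul_of_not_dvd {p : ℕ} (hp : p.Prime) {a b : ℤ} (ha : ¬ (p : ℤ) ∣ a) :
    padicValInt p (a * b) = padicValInt p b := by
  have : Fact p.Prime := ⟨hp⟩
  rcases eq_or_ne b 0 with rfl | hb
  · simp
  have ha0 : a ≠ 0 := by rintro rfl; exact ha (dvd_zero _)
  rw [padicValInt.mul ha0 hb, padicValInt.eq_zero_of_not_dvd ha, zero_add]

theorem Int.eq_of_forall_padicValInt_eq {a b : ℤ} (ha : 0 < a) (hb : 0 < b)
    (h : ∀ p : ℕ, p.Prime → padicValInt p a = padicValInt p b) : a = b := by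
  have : a.natAbs = b.natAbs := by
    refine Nat.eq_of_factorization_eq (by omega) (by omega) fun p => ?_
    by_cases hp : p.Prime
    · rw [Nat.factorization_def _ hp, Nat.factorization_def _ hp]
      exact h p hp
    · rw [Nat.factorization_eq_zero_of_not_prime _ hp, Nat.factorization_eq_zero_of_not_prime _ hp]
  omega

theorem Squarefree.not_prime_sq_dvd {R : Type*} [CommMonoidWithZero R] [IsCancelMulZero R] {a p : R}
    (ha : Squarefree a) (hp : Prime p) : ¬ p ^ 2 ∣ a := fun h =>
  hp.not_isUnit (ha p (by rwa [← pow_two]))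

variable {s t : ℤ} {x n m : ℕ}

theorem Odd.two_dvd_sq_add_one (ht : Odd t) : 2 ∣ t ^ 2 + 1 := by
  obtain ⟨k, rfl⟩ := ht
  exact ⟨2 * k ^ 2 + 2 * k + 1, by ring⟩

theorem Odd.not_four_dvd_sq_add_one (ht : Odd t) : ¬ 4 ∣ t ^ 2 + 1 := by
  obtain ⟨k, rfl⟩ := ht
  rw [show (2 * k + 1) ^ 2 + 1 = 4 * (k ^ 2 + k) + 2 by ring]
  omega

theorem not_dvd_of_dvd_of_gcd_eq_one {p : ℕ} (hp : p.Prime) {a b : ℤ} (h : Int.gcd a b = 1)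
    (hb : (p : ℤ) ∣ b) : ¬ (p : ℤ) ∣ a := fun ha => by
  have := Int.dvd_coe_gcd ha hb
  rw [h] at this
  exact (Nat.prime_iff_prime_int.1 hp).not_dvd_one (by simpa using this)

theorem not_two_dvd_of_sq_add_one_eq (ht : Odd t)
    (h : t ^ 2 + 1 = (x : ℤ) ^ 4 * n ^ 2 * m) : ¬ (2 : ℤ) ∣ n := fun ⟨k, hk⟩ =>
  ht.not_four_dvd_sq_add_one ⟨x ^ 4 * k ^ 2 * m, by rw [h, hk]; ring⟩

theorem two_dvd_of_sq_add_one_eq (ht : Odd t)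
    (h : t ^ 2 + 1 = (x : ℤ) ^ 4 * n ^ 2 * m) : (2 : ℤ) ∣ m := by
  have h2 := ht.two_dvd_sq_add_one
  rw [h] at h2
  have hp : Prime (2 : ℤ) := Int.prime_two
  rcases hp.dvd_or_dvd h2 with h2 | h2
  · rcases hp.dvd_or_dvd h2 with h2 | h2
    · obtain ⟨k, hk⟩ := hp.dvd_of_dvd_pow h2
      exact (ht.not_four_dvd_sq_add_one ⟨4 * k ^ 4 * n ^ 2 * m, by rw [h, hk]; ring⟩).elim
    · exact (not_two_dvd_of_sq_add_one_eq ht h (hp.dvd_of_dvd_pow h2)).elim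
  · exact h2

/-- The discriminant of `K_{cs,t}` for `c ∈ {±1, ±2}`. -/
theorem discr_quarticField_mul (hs : Squarefree s) (ht : Odd t)
    (hst : Int.gcd s (t ^ 2 + 1) = 1) {c : ℤ} (hc : c ∣ 2) {S : ℚ}
    (hS : S = (c * s : ℤ)) (hn : Squarefree n)
    (hm : Squarefree m) (h : t ^ 2 + 1 = (x : ℤ) ^ 4 * n ^ 2 * m) :
    discr (quarticField S t) =
      2 ^ 8 * s ^ 2 * ((n / Nat.gcd m n : ℕ) : ℤ) ^ 2 * m ^ 3 := by
  subst hS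
  have hs0 : s ≠ 0 := hs.ne_zero
  have ht0 : t ≠ 0 := by rintro rfl; simp at ht
  have hc0 : c ≠ 0 := by rintro rfl; simp at hc
  have hS0 : c * s ≠ 0 := mul_ne_zero hc0 hs0
  have hm2 := two_dvd_of_sq_add_one_eq ht h
  have hn2 := not_two_dvd_of_sq_add_one_eq ht h
  have hs2 : ¬ (2 : ℤ) ∣ s := not_dvd_of_dvd_of_gcd_eq_one Nat.prime_two hst ht.two_dvd_sq_add_one
  obtain ⟨n', hn'⟩ := Nat.gcd_dvd_right m n
  set g := Nat.gcd m n with hg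
  have hg0 : 0 < g := Nat.gcd_pos_of_pos_right m (Nat.pos_of_ne_zero hn.ne_zero)
  have hnn : n / g = n' := by rw [hn', Nat.mul_div_cancel_left _ hg0]
  rw [hnn]
  have hnZ : (n : ℤ) = g * n' := by exact_mod_cast hn'
  have hn'0 : n' ≠ 0 := by rintro rfl; exact hn.ne_zero (by rw [hn', mul_zero])
  have hgm : (g : ℤ) ∣ m := by exact_mod_cast Nat.gcd_dvd_left m n
  have hd : ((x : ℤ) ^ 2 * n) ^ 2 * m = t ^ 2 + 1 := by rw [h]; ring
  have hmd : (m : ℤ) ∣ t ^ 2 + 1 := ⟨((x : ℤ) ^ 2 * n) ^ 2, by rw [← hd]; ring⟩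
  have hnd : (n : ℤ) ∣ t ^ 2 + 1 := ⟨(x : ℤ) ^ 4 * n * m, by rw [h]; ring⟩
  obtain ⟨θ, γ, hT⟩ := exists_isQuarticTower hS0 ht0 hd
  -- A second tower for the same field, with e = 1. Here M need not be squarefree, since this tower
  -- serves only primes not dividing t² + 1.
  obtain ⟨θ₁, γ₁, hT₁⟩ := exists_isQuarticTower (x := 1) (n := 1) (M := t ^ 2 + 1) hS0 ht0 (by ring)
  rw [mul_one, one_pow, mul_one] at hT₁
  have hmsq : ∀ {p : ℕ}, p.Prime → ¬ (p : ℤ) ^ 2 ∣ m := fun {p} hp hd =>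
    hm.not_prime_sq_dvd (Nat.prime_iff.1 hp) (by exact_mod_cast hd)
  have hnsq : ∀ {p : ℕ}, p.Prime → ¬ (p : ℤ) ^ 2 ∣ n := fun {p} hp hd =>
    hn.not_prime_sq_dvd (Nat.prime_iff.1 hp) (by exact_mod_cast hd)
  have hpc : ∀ {p : ℕ}, p.Prime → p ≠ 2 → ¬ (p : ℤ) ∣ c := fun {p} hp hp2 hd =>
    hp.not_dvd_two_int hp2 (hd.trans hc)
  -- At 2 only c can contribute, and 4 ∤ c because c ∣ 2. At odd p ∣ t² + 1 only the squarefree n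
  -- can.
  have hpA : ∀ {p : ℕ}, p.Prime → (p : ℤ) ∣ t ^ 2 + 1 → ¬ (p : ℤ) ^ 2 ∣ c * s * n :=
    fun {p} hp hpd hdvd => by
      have hp' := Nat.prime_iff_prime_int.1 hp
      have hps := not_dvd_of_dvd_of_gcd_eq_one hp hst hpd
      by_cases hp2 : p = 2
      · subst hp2
        have h1 : IsCoprime (((2 : ℕ) : ℤ) ^ 2) (s * n) := by
          refine ((Prime.coprime_iff_not_dvd hp').2 fun h2 => ?_).pow_left
          rcases hp'.dvd_or_dvd h2 with h2 | h2
          exacts [hs2 h2, hn2 h2]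
        rw [mul_assoc] at hdvd
        have := Int.le_of_dvd two_pos ((h1.dvd_of_dvd_mul_right hdvd).trans hc)
        norm_num at this
      · have h1 : IsCoprime ((p : ℤ) ^ 2) (c * s) := by
          refine ((Prime.coprime_iff_not_dvd hp').2 fun h2 => ?_).pow_left
          rcases hp'.dvd_or_dvd h2 with h2 | h2
          exacts [hpc hp hp2 h2, hps h2]
        exact hnsq hp (h1.dvd_of_dvd_mul_left hdvd)
  have hpos := (hT.padicValInt_discr_of_dvd Nat.prime_two hm2 (hmsq Nat.prime_two)
    (hpA Nat.prime_two ht.two_dvd_sq_add_one)).1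
  have hm0 : (m : ℤ) ≠ 0 := by exact_mod_cast hm.ne_zero
  have hmpos : 0 < (m : ℤ) := by omega
  refine Int.eq_of_forall_padicValInt_eq hpos (by positivity) fun p hp => ?_
  have hp' := Nat.prime_iff_prime_int.1 hp
  by_cases hpm : (p : ℤ) ∣ m
  · rw [(hT.padicValInt_discr_of_dvd hp hpm (hmsq hp) (hpA hp (hpm.trans hmd))).2,
      show 2 ^ 8 * s ^ 2 * (n' : ℤ) ^ 2 * m ^ 3 = (s * n') ^ 2 * (2 ^ 8 * m ^ 3) by ring,
      padicValInt_mul_of_not_dvd hp (a := (s * n') ^ 2)]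
    intro h1
    rcases hp'.dvd_or_dvd (hp'.dvd_of_dvd_pow h1) with h1 | h1
    · exact not_dvd_of_dvd_of_gcd_eq_one hp hst (hpm.trans hmd) h1
    · have hpg : (p : ℤ) ∣ g := by
        have h2 : p ∣ n := by rw [hn']; exact (Int.natCast_dvd_natCast.1 h1).mul_left g
        exact_mod_cast Nat.dvd_gcd (Int.natCast_dvd_natCast.1 hpm) h2
      exact hnsq hp (by rw [hnZ, pow_two]; exact mul_dvd_mul hpg h1)
  have hp2 : p ≠ 2 := by rintro rfl; exact hpm hm2
  have hp2' : ¬ (p : ℤ) ∣ 2 := hp.not_dvd_two_int hp2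
  by_cases hpd : (p : ℤ) ∣ t ^ 2 + 1
  · have hpt : ¬ (p : ℤ) ∣ t := fun h1 => by
      have := dvd_sub hpd (h1.mul_left t)
      rw [show t ^ 2 + 1 - t * t = 1 by ring] at this
      exact hp'.not_dvd_one this
    have hps := not_dvd_of_dvd_of_gcd_eq_one hp hst hpd
    have hpg : ¬ (p : ℤ) ∣ g := fun h1 => hpm (h1.trans hgm)
    rw [hT.padicValInt_discr_of_not_dvd hp hp2 hpm hpt (hpA hp hpd), hnZ,
      show (c * s * (g * n')) ^ 2 = (c * s * g) ^ 2 * (n' : ℤ) ^ 2 by ring,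
      show 2 ^ 8 * s ^ 2 * (n' : ℤ) ^ 2 * m ^ 3 = 2 ^ 8 * s ^ 2 * m ^ 3 * (n' : ℤ) ^ 2 by ring,
      padicValInt_mul_of_not_dvd hp, padicValInt_mul_of_not_dvd hp]
    · intro h1
      rcases hp'.dvd_or_dvd h1 with h1 | h1
      · rcases hp'.dvd_or_dvd h1 with h1 | h1
        exacts [hp2' (hp'.dvd_of_dvd_pow h1), hps (hp'.dvd_of_dvd_pow h1)]
      · exact hpm (hp'.dvd_of_dvd_pow h1)
    · intro h1
      rcases hp'.dvd_or_dvd (hp'.dvd_of_dvd_pow h1) with h1 | h1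
      · rcases hp'.dvd_or_dvd h1 with h1 | h1
        exacts [hpc hp hp2 h1, hps h1]
      · exact hpg h1
  · have hpS : ¬ (p : ℤ) ^ 2 ∣ c * s := fun h1 =>
      hs.not_prime_sq_dvd hp' ((((Prime.coprime_iff_not_dvd hp').2
        (hpc hp hp2)).pow_left).dvd_of_dvd_mul_left h1)
    rw [hT₁.padicValInt_discr_of_e_eq_one hp hp2 hpd hpS, mul_pow,
      show 2 ^ 8 * s ^ 2 * (n' : ℤ) ^ 2 * m ^ 3 = 2 ^ 8 * (n' : ℤ) ^ 2 * m ^ 3 * s ^ 2 by ring,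
      padicValInt_mul_of_not_dvd hp, padicValInt_mul_of_not_dvd hp]
    · intro h1
      rcases hp'.dvd_or_dvd h1 with h1 | h1
      · rcases hp'.dvd_or_dvd h1 with h1 | h1
        · exact hp2' (hp'.dvd_of_dvd_pow h1)
        · exact hpd ((hp'.dvd_of_dvd_pow h1).trans ((Dvd.intro_left _ hnZ.symm).trans hnd))
      · exact hpm (hp'.dvd_of_dvd_pow h1)
    · exact fun h1 => hpc hp hp2 (hp'.dvd_of_dvd_pow h1)

theorem exists_pow_four_mul_sq_mul (d : ℕ) :
    ∃ x n m : ℕ, Squarefree n ∧ Squarefree m ∧ d = x ^ 4 * n ^ 2 * m := by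
  obtain ⟨m, e, rfl, hm⟩ := Nat.sq_mul_squarefree d
  obtain ⟨n, x, rfl, hn⟩ := Nat.sq_mul_squarefree e
  exact ⟨x, n, m, hn, hm, by ring⟩

end Discriminant

theorem proposition5p2 (s t : ℤ) (hs : Squarefree s) (ht : Odd t)
    (hst : Int.gcd s (t ^ 2 + 1) = 1) :
    -- the four fields have the same discriminant
    (NumberField.discr (quarticField (2 * s) t) = NumberField.discr (quarticField s t) ∧
      NumberField.discr (quarticField (-s) t) = NumberField.discr (quarticField s t) ∧
      NumberField.discr (quarticField (-(2 * s)) t) = NumberField.discr (quarticField s t)) ∧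
    -- its explicit value
    (∃ x n m : ℕ, Squarefree n ∧ Squarefree m ∧ t ^ 2 + 1 = (x : ℤ) ^ 4 * n ^ 2 * m) ∧
    (∀ x n m : ℕ, Squarefree n → Squarefree m → t ^ 2 + 1 = (x : ℤ) ^ 4 * n ^ 2 * m →
      (NumberField.discr (quarticField s t) : ℚ) =
        2 ^ 8 * (s : ℚ) ^ 2 * n ^ 2 * m ^ 3 / (Nat.gcd m n : ℚ) ^ 2) ∧
    -- the exponents of its prime factors
    padicValInt 2 (NumberField.discr (quarticField s t)) = 11 ∧
    (∀ p : ℕ, p.Prime → p ≠ 2 → (p : ℤ) ∣ s →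
      padicValInt p (NumberField.discr (quarticField s t)) = 2) ∧
    (∀ q : ℕ, q.Prime → q ≠ 2 → ¬ (q : ℤ) ∣ s → ¬ (q : ℤ) ∣ t ^ 2 + 1 →
      padicValInt q (NumberField.discr (quarticField s t)) = 0) := by
  have hex : ∃ x n m : ℕ, Squarefree n ∧ Squarefree m ∧
      t ^ 2 + 1 = (x : ℤ) ^ 4 * n ^ 2 * m := by
    obtain ⟨x, n, m, hn, hm, h⟩ := exists_pow_four_mul_sq_mul (t.natAbs ^ 2 + 1)
    refine ⟨x, n, m, hn, hm, ?_⟩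
    rw [← Int.natAbs_sq t]
    exact_mod_cast h
  have hone : ∀ {x n m : ℕ}, Squarefree n → Squarefree m →
      t ^ 2 + 1 = (x : ℤ) ^ 4 * n ^ 2 * m → discr (quarticField s t) =
        2 ^ 8 * s ^ 2 * ((n / Nat.gcd m n : ℕ) : ℤ) ^ 2 * m ^ 3 := fun hn hm h =>
    discr_quarticField_mul hs ht hst (one_dvd 2) (by simp) hn hm h
  obtain ⟨x, n, m, hn, hm, h⟩ := hex
  have hD := hone hn hm h
  set r := n / Nat.gcd m n with hr
  have hrn : (r : ℤ) ∣ n := by exact_mod_cast Nat.div_dvd_of_dvd (Nat.gcd_dvd_right m n)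
  have hnd : (n : ℤ) ∣ t ^ 2 + 1 := ⟨(x : ℤ) ^ 4 * n * m, by rw [h]; ring⟩
  have hmd : (m : ℤ) ∣ t ^ 2 + 1 := ⟨(x : ℤ) ^ 4 * n ^ 2, by rw [h]; ring⟩
  have hm2 := two_dvd_of_sq_add_one_eq ht h
  have hn2 := not_two_dvd_of_sq_add_one_eq ht h
  refine ⟨⟨?_, ?_, ?_⟩, ⟨x, n, m, hn, hm, h⟩, fun x n m hn hm h => ?_, ?_, fun p hp hp2 hps => ?_,
    fun q hq hq2 hqs hqt => ?_⟩
  · rw [hD, discr_quarticField_mul hs ht hst (dvd_refl 2) (by simp) hn hm h]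
  · rw [hD, discr_quarticField_mul hs ht hst (c := -1) (by norm_num) (by simp) hn hm h]
  · rw [hD, discr_quarticField_mul hs ht hst (c := -2) (by norm_num) (by simp) hn hm h]
  · have hg0 : (Nat.gcd m n : ℚ) ≠ 0 := by
      exact_mod_cast (Nat.gcd_pos_of_pos_right m (Nat.pos_of_ne_zero hn.ne_zero)).ne'
    rw [hone hn hm h]
    simp only [Int.cast_mul, Int.cast_pow, Int.cast_natCast, Int.cast_ofNat]
    rw [Nat.cast_div (Nat.gcd_dvd_right m n) hg0]
    field_simp
  · obtain ⟨k, hk⟩ := hm2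
    have hp : Prime (2 : ℤ) := Int.prime_two
    have hs2 : ¬ (2 : ℤ) ∣ s :=
      not_dvd_of_dvd_of_gcd_eq_one Nat.prime_two hst ht.two_dvd_sq_add_one
    have hk2 : ¬ (2 : ℤ) ∣ k := fun ⟨l, hl⟩ => ht.not_four_dvd_sq_add_one <|
      Dvd.dvd.trans ⟨l, by rw [hk, hl]; ring⟩ hmd
    -- The exponent is 11 = 8 + 3: 2 divides m exactly once since 4 ∤ t² + 1, and m enters cubed.
    rw [hD, hk, show 2 ^ 8 * s ^ 2 * (r : ℤ) ^ 2 * (2 * k) ^ 3 =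
      (s ^ 2 * r ^ 2 * k ^ 3) * 2 ^ 11 by ring, padicValInt_mul_of_not_dvd Nat.prime_two]
    · exact padicValNat.prime_pow 11
    · intro h1
      rcases hp.dvd_or_dvd h1 with h1 | h1
      · rcases hp.dvd_or_dvd h1 with h1 | h1
        exacts [hs2 (hp.dvd_of_dvd_pow h1), hn2 ((hp.dvd_of_dvd_pow h1).trans hrn)]
      · exact hk2 (hp.dvd_of_dvd_pow h1)
  · have : Fact p.Prime := ⟨hp⟩
    have hp' := Nat.prime_iff_prime_int.1 hp
    have hpd : ¬ (p : ℤ) ∣ t ^ 2 + 1 := fun h1 => not_dvd_of_dvd_of_gcd_eq_one hp hst h1 hps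
    have hp2' : ¬ (p : ℤ) ∣ 2 := hp.not_dvd_two_int hp2
    obtain ⟨k, hk⟩ := hps
    have hpk : ¬ (p : ℤ) ∣ k := fun h1 =>
      hs.not_prime_sq_dvd hp' (by rw [hk, pow_two]; exact mul_dvd_mul_left _ h1)
    rw [hD, hk, show 2 ^ 8 * (p * k) ^ 2 * (r : ℤ) ^ 2 * m ^ 3 =
      (2 ^ 8 * k ^ 2 * r ^ 2 * m ^ 3) * (p : ℤ) ^ 2 by ring, padicValInt_mul_of_not_dvd hp]
    · rw [padicValInt, Int.natAbs_pow, Int.natAbs_natCast]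
      exact padicValNat.prime_pow 2
    · intro h1
      rcases hp'.dvd_or_dvd h1 with h1 | h1
      · rcases hp'.dvd_or_dvd h1 with h1 | h1
        · rcases hp'.dvd_or_dvd h1 with h1 | h1
          exacts [hp2' (hp'.dvd_of_dvd_pow h1), hpk (hp'.dvd_of_dvd_pow h1)]
        · exact hpd ((hp'.dvd_of_dvd_pow h1).trans (hrn.trans hnd))
      · exact hpd ((hp'.dvd_of_dvd_pow h1).trans hmd)
  · have hq' := Nat.prime_iff_prime_int.1 hq
    have hq2' : ¬ (q : ℤ) ∣ 2 := hq.not_dvd_two_int hq2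
    rw [hD]
    refine padicValInt.eq_zero_of_not_dvd fun h1 => ?_
    rcases hq'.dvd_or_dvd h1 with h1 | h1
    · rcases hq'.dvd_or_dvd h1 with h1 | h1
      · rcases hq'.dvd_or_dvd h1 with h1 | h1
        exacts [hq2' (hq'.dvd_of_dvd_pow h1), hqs (hq'.dvd_of_dvd_pow h1)]
      · exact hqt ((hq'.dvd_of_dvd_pow h1).trans (hrn.trans hnd))
    · exact hqt ((hq'.dvd_of_dvd_pow h1).trans hmd)
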